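/- **Setting.** Let $k\ge 3$, let $\mathcal A\in\mathbb R^{n_1}\otimes\dots\otimes\mathbb R^{n_k}$ be a nonzero tensor, and let $V(r,m)=\{U\in\mathbb R^{m\times r}: U^{\mathsf T}U=I\}$. For $\mathbb U=(U^{(1)},\dots,U^{(k)})$ with $U^{(i)}\in\mathbb R^{n_i\times r}$ having columns $\mathbf u^{(i)}_1,\dots,\mathbf u^{(i)}_r$, put $\|\mathbb U\|_F^2=\sum_i\|U^{(i)}\|_F^2$, $$\lambda_j(\mathbb U)=\langle\mathcal A,\mathbf u^{(1)}_j\otimes\dots\otimes\mathbf u^{(k)}_j\rangle,\qquad f(\mathbb U)=\sum_{j=1}^r\lambda_j(\mathbb U)^2,\qquad \Lambda(\mathbb U)=\operatorname{diag}(\lambda_1(\mathbb U),\dots,\lambda_r(\mathbb U)),$$ and let $V^{(i)}(\mathbb U)\in\mathbb R^{n_i\times r}$ be the matrix whose $j$-th column is the contraction of $\mathcal A$ with the vectors $\mathbf u^{(l)}_j$, $l\ne i$. **KKT points.** A tuple $\mathbb U\in V(r,n_1)\times\dots\times V(r,n_k)$ is a KKT point of $\max f$ over this set if for every $i$ there is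 a symmetric $P_i\in\mathbb R^{r\times r}$ with $V^{(i)}(\mathbb U)\Lambda(\mathbb U)=U^{(i)}P_i$. It is nondegenerate if, with $\mathbf x=(\lambda_1(\mathbb U),\dots,\lambda_r(\mathbb U))$, the pair $(\mathbb U,\mathbf x)$ lies in the manifold $U_{\mathbf n,r}=V(r,n_1)\times\dots\times V(r,n_k)\times(\mathbb R\setminus\{0\})^r$ and is a nondegenerate critical point (the differential vanishes and the Hessian in local coordinates is nonsingular) on $U_{\mathbf n,r}$ of $$g(\mathbb U,\mathbf x)=\tfrac12\Big\|\mathcal A-\sum_{j=1}^r x_j\,\mathbf u^{(1)}_j\otimes\dots\otimes\mathbf u^{(k)}_j\Big\|^2 .$$ **The iAPD algorithm.** Choose $r\ge1$, $\epsilon>0$, a tuple $\mathbb U_{[0]}\in V(r,n_1)\times\dots\times V(r,n_k)$ with $f(\mathbb U_{[0]})>0$, and $\kappa\in(0,\sqrt{f(\mathbb U_{[0]})/r})$. For $p=1,2,\dots$: 1. For $i=1,\dots,k$ in turn, let $\mathbb W=(U^{(1)}_{[p]},\dots,U^{(i-1)}_{[p]},U^{(i)}_{[p-1]},\dots,U^{(k)}_{[p-1]})$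 and $B=V^{(i)}(\mathbb W)\Lambda(\mathbb W)$, and take a singular value decomposition $B=G\Sigma H^{\mathsf T}$ with $G\in V(r,n_i)$, $H$ orthogonal, and $\Sigma$ diagonal with nonincreasing nonnegative diagonal entries. If the smallest singular value is at least $\epsilon$, set $U^{(i)}_{[p]}=GH^{\mathsf T}$. Otherwise let $U^{(i)}_{[p]}\in V(r,n_i)$ be the orthonormal factor of some polar decomposition $B+\epsilon U^{(i)}_{[p-1]}=U^{(i)}_{[p]}S$ with $S$ symmetric positive semidefinite. 2. (Truncation.) With $\lambda_j=\lambda_j(\mathbb U_{[p]})$, delete from all $U^{(i)}_{[p]}$ the columns with indices in a set $J$ such that $\{j:|\lambda_j|<\kappa\}\subseteq J\subseteq\{j:\lambda_j<\kappa\}$ (this covers both the test $\lambda_j<\kappa$ and the test $|\lambda_j|<\kappa$), and replace $r$ by $r-|J|$. **Theorem (Linear Convergence Rate).** Let $(\mathbb U_{[p]})_{p\ge0}$ be an infinite sequence generated by iAPD, and suppose that $\mathbb U_{[p]}\to\mathbb U^*$ (so the number of columns is eventually that of $\mathbb U^*$), where $\mathbb U^*$ is a nondegenerate KKT point (with $r$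 in the definition equal to the number of columns of $\mathbb U^*$). Then $f(\mathbb U_{[p]})$ converges $Q$-linearly to $f(\mathbb U^*)$, that is, $f(\mathbb U_{[p]})\to f(\mathbb U^*)$ and there is $q\in(0,1)$ with $$|f(\mathbb U_{[p+1]})-f(\mathbb U^*)|\le q\,|f(\mathbb U_{[p]})-f(\mathbb U^*)|\quad\text{for all sufficiently large }p,$$ and $\mathbb U_{[p]}$ converges $R$-linearly to $\mathbb U^*$, that is, there are $M\in\mathbb R$ and $q\in(0,1)$ with $$\|\mathbb U_{[p]}-\mathbb U^*\|_F\le M q^p\quad\text{for all sufficiently large }p.$$ -/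

import Mathlib

namespace LROTA

open Filter Topology
open scoped Matrix ContDiff

variable {k : ℕ} {n : Fin k → ℕ}

/-! ### Tensors and tuples of factor matrices -/

/-- Real tensors of size `n₁ × ⋯ × n_k`. -/
abbrev Tensor {k : ℕ} (n : Fin k → ℕ) : Type := (∀ i : Fin k, Fin (n i)) → ℝ

/-- Tuples `𝕌 = (U⁽¹⁾, …, U⁽ᵏ⁾)` with `U⁽ⁱ⁾` an `nᵢ × r` matrix. -/
abbrev Factors {k : ℕ} (n : Fin k → ℕ) (r : ℕ) : Type :=
  ∀ i : Fin k, Matrix (Fin (n i)) (Fin r) ℝ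

/-- The block vector `𝐱_j = (𝐮⁽¹⁾_j, …, 𝐮⁽ᵏ⁾_j)` of the `j`-th columns of the factor matrices. -/
def cols {r : ℕ} (U : Factors n r) (j : Fin r) : ∀ i : Fin k, Fin (n i) → ℝ :=
  fun i a => U i a j

/-- `𝒜 τ(𝐱) = ⟨𝒜, 𝐱₁ ⊗ ⋯ ⊗ 𝐱_k⟩`. -/
def contract (A : Tensor n) (x : ∀ i : Fin k, Fin (n i) → ℝ) : ℝ :=
  ∑ a : (∀ i : Fin k, Fin (n i)), A a * ∏ l, x l (a l)

/-- The vector `𝒜 τᵢ(𝐱) ∈ ℝ^{nᵢ}`: contraction of `𝒜` with all `𝐱_l`, `l ≠ i`. -/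
def contractExcept (A : Tensor n) (i : Fin k) (x : ∀ i : Fin k, Fin (n i) → ℝ) :
    Fin (n i) → ℝ :=
  fun b => ∑ a : (∀ i : Fin k, Fin (n i)),
    if a i = b then A a * ∏ l ∈ Finset.univ.erase i, x l (a l) else 0

/-- The relation `⟨𝒜 τᵢ(𝐱), 𝐱ᵢ⟩ = 𝒜 τ(𝐱)` that characterizes `𝒜 τᵢ(𝐱)`. -/
theorem sum_contractExcept_mul (A : Tensor n) (i : Fin k) (x : ∀ i : Fin k, Fin (n i) → ℝ) :
    ∑ b, contractExcept A i x b * x i b = contract A x := by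
  simp only [contractExcept, contract, Finset.sum_mul, ite_mul, zero_mul]
  rw [Finset.sum_comm]
  refine Finset.sum_congr rfl fun a _ => ?_
  rw [Finset.sum_ite_eq, if_pos (Finset.mem_univ _), mul_assoc,
    Finset.prod_erase_mul _ _ (Finset.mem_univ i)]

/-- `λ_j(𝕌) = (((U⁽¹⁾)ᵀ, …, (U⁽ᵏ⁾)ᵀ) · 𝒜)_{j…j} = 𝒜 τ(𝐱_j)`. -/
def lam {r : ℕ} (A : Tensor n) (U : Factors n r) : Fin r → ℝ :=
  fun j => contract A (cols U j)

/-- The objective function `f(𝕌) = ∑_j λ_j(𝕌)²` of the maximization problem. -/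
def objective {r : ℕ} (A : Tensor n) (U : Factors n r) : ℝ :=
  ∑ j, lam A U j ^ 2

/-- The matrix `V⁽ⁱ⁾` with columns `𝒜 τᵢ(𝐱_j)`. -/
def vMat {r : ℕ} (A : Tensor n) (U : Factors n r) (i : Fin k) :
    Matrix (Fin (n i)) (Fin r) ℝ :=
  Matrix.of fun b j => contractExcept A i (cols U j) b

/-- The matrix `V⁽ⁱ⁾ Λ`, where `Λ = diag(λ₁(𝕌), …, λ_r(𝕌))`. -/
def vLam {r : ℕ} (A : Tensor n) (U : Factors n r) (i : Fin k) :
    Matrix (Fin (n i)) (Fin r) ℝ :=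
  vMat A U i * Matrix.diagonal (lam A U)

/-- `U ∈ V(r, m)`: the matrix `U` has orthonormal columns. -/
def Stiefel {m r : ℕ} (U : Matrix (Fin m) (Fin r) ℝ) : Prop := Uᵀ * U = 1

/-! ### KKT points and nondegeneracy -/

/-- KKT points of `max f(𝕌)` subject to `(U⁽ⁱ⁾)ᵀ U⁽ⁱ⁾ = I` for all `i`. -/
def IsKKT {r : ℕ} (A : Tensor n) (U : Factors n r) : Prop :=
  (∀ i, Stiefel (U i)) ∧
    ∀ i, ∃ P : Matrix (Fin r) (Fin r) ℝ, P.IsSymm ∧ vLam A U i - U i * P = 0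

/-- The tensor `(U⁽¹⁾, …, U⁽ᵏ⁾) · diag(x) = ∑_j x_j 𝐮⁽¹⁾_j ⊗ ⋯ ⊗ 𝐮⁽ᵏ⁾_j`. -/
def odTensor {r : ℕ} (U : Factors n r) (x : Fin r → ℝ) : Tensor n :=
  fun a => ∑ j, x j * ∏ i, U i (a i) j

/-- The vector space `ℝ^{n₁×r} × ⋯ × ℝ^{n_k×r} × ℝ^r`, with matrices as plain functions so that it
carries the standard normed structure (only its smooth structure is used below). -/
abbrev Ambient {k : ℕ} (n : Fin k → ℕ) (r : ℕ) : Type :=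
  (∀ i : Fin k, Fin (n i) → Fin r → ℝ) × (Fin r → ℝ)

/-- The factor matrices of a point of the ambient space. -/
def Ambient.factors {r : ℕ} (z : Ambient n r) : Factors n r := fun i => Matrix.of (z.1 i)

/-- The point `(𝕌, x)` of the ambient space. -/
def Ambient.mk {r : ℕ} (U : Factors n r) (x : Fin r → ℝ) : Ambient n r :=
  (fun i a j => U i a j, x)

/-- `g(𝕌, x) = ½ ‖𝒜 - (U⁽¹⁾, …, U⁽ᵏ⁾) · diag(x)‖²` (Hilbert–Schmidt norm). -/
noncomputable def g {r : ℕ} (A : Tensor n) (z : Ambient n r) : ℝ :=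
  (1 / 2) * ∑ a, (A a - odTensor z.factors z.2 a) ^ 2

/-- `U_{𝐧,r} = V(r,n₁) × ⋯ × V(r,n_k) × (ℝ ∖ {0})^r`, as a subset of its ambient vector space. -/
def paramManifold {k : ℕ} (n : Fin k → ℕ) (r : ℕ) : Set (Ambient n r) :=
  {z | (∀ i, Stiefel (z.factors i)) ∧ ∀ j, z.2 j ≠ 0}

/-- `ψ : Ω → M` is a local parametrization (the inverse of a chart) of the `d`-dimensional
embedded smooth submanifold `M` of `E`: `Ω ⊆ ℝᵈ` is open, `ψ` is a smooth injective immersion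
on `Ω` and a homeomorphism of `Ω` onto a relatively open subset of `M`. -/
structure IsLocalParametrization {E : Type*} [NormedAddCommGroup E] [NormedSpace ℝ E] {d : ℕ}
    (M : Set E) (Ω : Set (EuclideanSpace ℝ (Fin d))) (ψ : EuclideanSpace ℝ (Fin d) → E) :
    Prop where
  isOpen_source : IsOpen Ω
  smooth : ContDiffOn ℝ ∞ ψ Ω
  injOn : Set.InjOn ψ Ω
  immersion : ∀ y ∈ Ω, Function.Injective (fderiv ℝ ψ y)
  isOpen_image : ∀ W ⊆ Ω, IsOpen W → ∃ O : Set E, IsOpen O ∧ ψ '' W = M ∩ O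

/-- `z` is a nondegenerate critical point of `φ` on the submanifold `M`: in local coordinates of
`M` around `z` the differential of `φ` vanishes and its Hessian matrix is nonsingular. (At a
critical point this does not depend on the coordinates.) -/
def IsNondegenerateCriticalPoint {E : Type*} [NormedAddCommGroup E] [NormedSpace ℝ E]
    (M : Set E) (φ : E → ℝ) (z : E) : Prop :=
  ∃ (d : ℕ) (Ω : Set (EuclideanSpace ℝ (Fin d))) (ψ : EuclideanSpace ℝ (Fin d) → E)
    (y : EuclideanSpace ℝ (Fin d)),
    IsLocalParametrization M Ω ψ ∧ y ∈ Ω ∧ ψ y = z ∧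
    fderiv ℝ (φ ∘ ψ) y = 0 ∧
    ∀ v, (∀ w, fderiv ℝ (fderiv ℝ (φ ∘ ψ)) y v w = 0) → v = 0

/-- `𝕌` is a nondegenerate KKT point: it is a KKT point, and with
`x = Diag(((U⁽¹⁾)ᵀ, …, (U⁽ᵏ⁾)ᵀ) · 𝒜)` the pair `(𝕌, x)` lies in `U_{𝐧,r}` and is a nondegenerate
critical point of `g` on `U_{𝐧,r}`. -/
def IsNondegenerateKKT {r : ℕ} (A : Tensor n) (U : Factors n r) : Prop :=
  IsKKT A U ∧ Ambient.mk U (lam A U) ∈ paramManifold n r ∧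
    IsNondegenerateCriticalPoint (paramManifold n r) (g A)
      (Ambient.mk U (lam A U))

/-! ### The algorithm -/

/-- `B = G Σ Hᵀ` is a singular value decomposition with `G ∈ V(r,m)`, `H ∈ O(r)` and
`Σ = diag(σ)`, the singular values `σ` being ordered nonincreasingly. -/
structure IsSVD {m r : ℕ} (B : Matrix (Fin m) (Fin r) ℝ) (G : Matrix (Fin m) (Fin r) ℝ)
    (σ : Fin r → ℝ) (H : Matrix (Fin r) (Fin r) ℝ) : Prop where
  left_orth : Stiefel G
  right_orth : Stiefel H
  antitone : Antitone σ
  nonneg : ∀ j, 0 ≤ σ j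
  eq : B = G * Matrix.diagonal σ * Hᵀ

/-- `B = U S` is a polar decomposition: `U ∈ V(r,m)`, `S` symmetric positive semidefinite. -/
structure IsPolar {m r : ℕ} (B : Matrix (Fin m) (Fin r) ℝ) (U : Matrix (Fin m) (Fin r) ℝ)
    (S : Matrix (Fin r) (Fin r) ℝ) : Prop where
  orth : Stiefel U
  posSemidef : S.PosSemidef
  eq : B = U * S

/-- One factor update with data matrix `B = V⁽ⁱ⁾ Λ⁽ⁱ⁾`: from an SVD `B = G Σ Hᵀ` take `U' = G Hᵀ`
if the smallest singular value is at least `ε`; otherwise `U'` is an orthonormal polar factor of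
`B + ε U`. -/
def IsFactorUpdate {m r : ℕ} (ε : ℝ) (B U U' : Matrix (Fin m) (Fin r) ℝ) : Prop :=
  ∃ G σ H, IsSVD B G σ H ∧
    (((∀ j, ε ≤ σ j) ∧ U' = G * Hᵀ) ∨
      ((∃ j, σ j < ε) ∧ ∃ S, IsPolar (B + ε • U) U' S))

/-- `(U'⁽¹⁾, …, U'⁽ⁱ⁻¹⁾, U⁽ⁱ⁾, …, U⁽ᵏ⁾)`: the factors available when the `i`-th one is updated. -/
def mixed {r : ℕ} (U U' : Factors n r) (i : Fin k) : Factors n r :=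
  fun l => if l < i then U' l else U l

/-- One sweep of alternating polar decompositions with proximal corrections, from `U` to `U'`. -/
def IsSweep {r : ℕ} (A : Tensor n) (ε : ℝ) (U U' : Factors n r) : Prop :=
  ∀ i, IsFactorUpdate ε (vLam A (mixed U U' i) i) (U i) (U' i)

/-- Truncation: the columns with indices in `J` are deleted from all factor matrices and the
others are kept in their order. Every `j` with `|λ_j| < κ` belongs to `J`, and every `j ∈ J` has
`λ_j < κ`. Thus both the test `λ_j < κ` and the test `|λ_j| < κ` are covered; no column is deleted
if `J` is empty. -/
def IsTruncation {r r' : ℕ} (A : Tensor n) (κ : ℝ) (U : Factors n r) (U' : Factors n r') : Prop :=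
  ∃ J : Set (Fin r), (∀ j, |lam A U j| < κ → j ∈ J) ∧ (∀ j ∈ J, lam A U j < κ) ∧
    ∃ e : Fin r' ↪o Fin r, Set.range e = Jᶜ ∧ ∀ i, U' i = (U i).submatrix id e

/-- `𝕌_{[p]}`, `p = 0, 1, 2, …`, is a sequence generated by the iAPD algorithm for the tensor `A`
with proximal parameter `ε` and truncation parameter `κ`; `r p` is the number of columns of the
factor matrices of `𝕌_{[p]}`. -/
structure IsIAPDSequence (A : Tensor n) (ε κ : ℝ) (r : ℕ → ℕ) (U : ∀ p, Factors n (r p)) :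
    Prop where
  rank_pos : 0 < r 0
  prox_pos : 0 < ε
  init_orth : ∀ i, Stiefel (U 0 i)
  init_pos : 0 < objective A (U 0)
  trunc_pos : 0 < κ
  trunc_lt : κ < √(objective A (U 0) / r 0)
  step : ∀ p, ∃ W : Factors n (r p), IsSweep A ε (U p) W ∧ IsTruncation A κ W (U (p + 1))

/-! ### Convergence -/

/-- `‖𝕌 - 𝕎‖_F`, where `‖𝕌‖_F² = ∑ᵢ ‖U⁽ⁱ⁾‖_F²`. -/
noncomputable def frobDist {r : ℕ} (U W : Factors n r) : ℝ :=
  √(∑ i, ∑ a, ∑ j, (U i a j - W i a j) ^ 2)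

/-- `𝕌` viewed as a tuple of matrices with `s` columns, when `r = s`. -/
def castCols {r s : ℕ} (h : r = s) (U : Factors n r) : Factors n s :=
  fun i => (U i).submatrix id (Fin.cast h.symm)

/-- `𝕌_{[p]} → 𝕌*`: the number of columns is eventually that of `𝕌*`, and the distance to `𝕌*`
tends to zero. -/
def ConvergesTo {s : ℕ} {r : ℕ → ℕ} (U : ∀ p, Factors n (r p)) (Ustar : Factors n s) : Prop :=
  ∀ δ > 0, ∃ N, ∀ p ≥ N, ∃ h : r p = s, frobDist (castCols h (U p)) Ustar < δ

/-- `𝕌_{[p]} → 𝕌*` `R`-linearly: `‖𝕌_{[p]} - 𝕌*‖_F ≤ M qᵖ` for all large `p`, with `q < 1`. -/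
def RLinearlyConvergesTo {s : ℕ} {r : ℕ → ℕ} (U : ∀ p, Factors n (r p)) (Ustar : Factors n s) :
    Prop :=
  ∃ M q : ℝ, 0 < q ∧ q < 1 ∧
    ∃ N, ∀ p ≥ N, ∃ h : r p = s, frobDist (castCols h (U p)) Ustar ≤ M * q ^ p

/-- `a p → L` `Q`-linearly: `|a (p+1) - L| ≤ q |a p - L|` for all large `p`, with `q < 1`. -/
def QLinearlyConvergesTo (a : ℕ → ℝ) (L : ℝ) : Prop :=
  Tendsto a atTop (𝓝 L) ∧
    ∃ q : ℝ, 0 < q ∧ q < 1 ∧ ∀ᶠ p in atTop, |a (p + 1) - L| ≤ q * |a p - L|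

end LROTA

namespace LROTA

open Filter Topology
open scoped Matrix ContDiff

variable {k : ℕ} {n : Fin k → ℕ}

/-! ### The Łojasiewicz inequality at nondegenerate critical points -/

/-! A sufficient decrease is played against an error bound. Let `D` be the squared Frobenius length
of a sweep. In either branch a factor update is a polar decomposition, and this forces a gain of the
linearized objective proportional to `ε` times the squared step. The objective is a sum of squares
of functions linear in each single factor, so convexity turns the linear gain into a true one, and
summing over the factors gives `f(𝕌') - f(𝕌) ≥ ε D` (`IsSweep.increase`).

The same polar decompositions are approximate stationarity equations, so near the limit the KKT
residual after a sweep is `O(√D)` (`exists_residual_le`). Nondegeneracy enters through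
`objective_gap_le`. On Stiefel tuples `g(𝕌, λ(𝕌)) = ½(‖A‖² - f(𝕌))`, and the differential of `g`
along the manifold at `(𝕌, λ(𝕌))` is minus the pairing of the KKT residual with the tangent vector,
for any symmetric multipliers. In local coordinates a nonsingular Hessian gives the Łojasiewicz
inequality with exponent `1/2` (`abs_sub_le_sq_norm_fderiv`), so the gap `f* - f` is bounded by a
constant times the squared residual.

Hence `gap_{p+1} ≤ K D ≤ (K/ε)(gap_p - gap_{p+1})`, a contraction of the gap (`linear_rates`). The
step lengths are at most a constant times the square root of the gap, so they decay geometrically,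
and summing them gives the `R`-linear rate. Truncation is trivial once the number of columns is
constant. -/

/-- The Łojasiewicz inequality with exponent `1/2` at a nondegenerate critical point. -/
theorem abs_sub_le_sq_norm_fderiv {E : Type*} [NormedAddCommGroup E] [NormedSpace ℝ E]
    [FiniteDimensional ℝ E] {h : E → ℝ} {y : E} (hh : ContDiffAt ℝ 2 h y)
    (hcrit : fderiv ℝ h y = 0)
    (hnd : ∀ v, (∀ w, fderiv ℝ (fderiv ℝ h) y v w = 0) → v = 0) :
    ∃ C : ℝ, 0 < C ∧ ∀ᶠ y' in 𝓝 y, |h y' - h y| ≤ C * ‖fderiv ℝ h y'‖ ^ 2 := by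
  set H := fderiv ℝ (fderiv ℝ h) y with hH
  have hdiff : DifferentiableAt ℝ (fderiv ℝ h) y :=
    (hh.fderiv_right (m := 1) (by norm_num)).differentiableAt (by norm_num)
  -- Nonsingularity makes `H` injective, and an injective linear map on a finite-dimensional space
  -- is bounded below.
  obtain ⟨K, hK0, hlow⟩ : ∃ K : ℝ, 0 < K ∧ ∀ v, ‖v‖ ≤ K * ‖H v‖ := by
    obtain ⟨K, hK0, hK⟩ := LinearMap.exists_antilipschitzWith (H : E →ₗ[ℝ] (E →L[ℝ] ℝ))
      (LinearMap.ker_eq_bot'.2 fun v hv => hnd v fun w => by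
        have : H v = 0 := hv
        simp [this])
    exact ⟨K, hK0, fun v => by simpa [dist_eq_norm] using hK.le_mul_dist v 0⟩
  -- With this tolerance the linearization error, multiplied by `K`, is half of `‖y' - y‖` and can
  -- be absorbed on the left.
  have hc : (0 : ℝ) < (2 * K)⁻¹ := by positivity
  have happrox : ∀ᶠ y' in 𝓝 y, ‖fderiv ℝ h y' - H (y' - y)‖ ≤ (2 * K)⁻¹ * ‖y' - y‖ := by
    have := hdiff.hasFDerivAt.isLittleO.def hc
    filter_upwards [this] with y' hy'
    simpa [hcrit, hH] using hy'
  have hdiffs : ∀ᶠ y' in 𝓝 y, DifferentiableAt ℝ h y' :=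
    (hh.eventually (by simp)).mono fun _ hx => hx.differentiableAt (by norm_num)
  set B : ℝ := ‖H‖ + (2 * K)⁻¹ with hB
  have hB0 : 0 < B := by positivity
  refine ⟨B * (2 * K) ^ 2, by positivity, ?_⟩
  obtain ⟨δ, hδ, hball⟩ := Metric.eventually_nhds_iff_ball.1 (happrox.and hdiffs)
  filter_upwards [Metric.ball_mem_nhds y hδ] with y' hy'
  have hy'δ : ‖y' - y‖ < δ := by simpa [dist_eq_norm] using hy'
  have hgrad : ‖y' - y‖ ≤ 2 * K * ‖fderiv ℝ h y'‖ := by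
    have h1 := (hball y' hy').1
    have h2 := hlow (y' - y)
    have h3 : ‖H (y' - y)‖ ≤ ‖fderiv ℝ h y'‖ + (2 * K)⁻¹ * ‖y' - y‖ := by
      have := norm_sub_norm_le (H (y' - y)) (fderiv ℝ h y')
      rw [norm_sub_rev] at this
      linarith
    have h4 : ‖y' - y‖ ≤ K * (‖fderiv ℝ h y'‖ + (2 * K)⁻¹ * ‖y' - y‖) :=
      h2.trans (by gcongr)
    have h5 : K * ((2 * K)⁻¹ * ‖y' - y‖) = ‖y' - y‖ / 2 := by field_simp
    rw [mul_add, h5] at h4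
    linarith
  -- Mean value inequality on the ball of radius `‖y' - y‖`, where the derivative is itself at most
  -- `B * ‖y' - y‖`; this makes the bound quadratic.
  have hval : |h y' - h y| ≤ B * ‖y' - y‖ * ‖y' - y‖ := by
    have hsub : Metric.closedBall y ‖y' - y‖ ⊆ Metric.ball y δ := Metric.closedBall_subset_ball hy'δ
    have := (convex_closedBall y ‖y' - y‖).norm_image_sub_le_of_norm_fderiv_le (𝕜 := ℝ) (f := h)
      (C := B * ‖y' - y‖) (fun x hx => (hball x (hsub hx)).2) (fun x hx => ?_)
      (Metric.mem_closedBall_self (norm_nonneg _)) (y := y') (by simp [dist_eq_norm])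
    · simpa using this
    · have hx' : ‖x - y‖ ≤ ‖y' - y‖ := by simpa [dist_eq_norm] using hx
      have h1 := (hball x (hsub hx)).1
      have h2 := H.le_opNorm (x - y)
      have h3 : ‖fderiv ℝ h x‖ ≤ B * ‖x - y‖ := by
        have := norm_sub_norm_le (fderiv ℝ h x) (H (x - y))
        rw [hB]; linarith
      exact h3.trans (by gcongr)
  calc |h y' - h y| ≤ B * (‖y' - y‖ * ‖y' - y‖) := by rw [← mul_assoc]; exact hval
    _ ≤ B * ((2 * K * ‖fderiv ℝ h y'‖) * (2 * K * ‖fderiv ℝ h y'‖)) := by gcongr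
    _ = B * (2 * K) ^ 2 * ‖fderiv ℝ h y'‖ ^ 2 := by ring

/-! ### Differentiating the contraction -/

theorem hasDerivAt_contract (A : Tensor n) {x : ℝ → ∀ i : Fin k, Fin (n i) → ℝ}
    {x' : ∀ i : Fin k, Fin (n i) → ℝ} {t : ℝ}
    (hx : ∀ i b, HasDerivAt (fun t => x t i b) (x' i b) t) :
    HasDerivAt (fun t => contract A (x t)) (∑ i, ∑ b, contractExcept A i (x t) b * x' i b) t := by
  have h : HasDerivAt (fun t => contract A (x t))
      (∑ a : (∀ i : Fin k, Fin (n i)),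
        A a * ∑ i, (∏ l ∈ Finset.univ.erase i, x t l (a l)) • x' i (a i)) t :=
    HasDerivAt.fun_sum fun a _ =>
      (HasDerivAt.fun_finsetProd fun i _ => hx i (a i)).const_mul (A a)
  convert h using 1
  simp only [Finset.mul_sum, contractExcept, Finset.sum_mul, ite_mul, zero_mul]
  rw [Finset.sum_comm (s := (Finset.univ : Finset (∀ i : Fin k, Fin (n i))))]
  refine Finset.sum_congr rfl fun i _ => ?_
  rw [Finset.sum_comm]
  refine Finset.sum_congr rfl fun a _ => ?_
  rw [Finset.sum_ite_eq, if_pos (Finset.mem_univ _), smul_eq_mul, mul_assoc]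

theorem vLam_apply {r : ℕ} (A : Tensor n) (U : Factors n r) (i : Fin k) (b : Fin (n i))
    (j : Fin r) : vLam A U i b j = contractExcept A i (cols U j) b * lam A U j := by
  simp [vLam, vMat, Matrix.mul_diagonal]

theorem Stiefel.sum_mul {m r : ℕ} {U : Matrix (Fin m) (Fin r) ℝ} (hU : Stiefel U)
    (j l : Fin r) : ∑ b, U b j * U b l = if j = l then 1 else 0 := by
  have := congrFun (congrFun hU j) l
  simpa [Matrix.mul_apply, Matrix.one_apply] using this

/-! ### The restriction of `g` to the manifold -/

/-- Inner products of rank-one tensors factor into products of inner products of columns, so the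
rank-one terms are orthonormal. At least one factor is needed: an empty product would be `1` also
for distinct indices. -/
theorem sum_odTensor_sq {r : ℕ} (hk : 0 < k) {U : Factors n r} (hU : ∀ i, Stiefel (U i))
    (x : Fin r → ℝ) : ∑ a, odTensor U x a ^ 2 = ∑ j, x j ^ 2 := by
  have : Nonempty (Fin k) := ⟨⟨0, hk⟩⟩
  have hprod : ∀ j l : Fin r, ∑ a : (∀ i : Fin k, Fin (n i)), ∏ i, U i (a i) j * U i (a i) l
      = if j = l then 1 else 0 := by
    intro j l
    have h := Finset.prod_univ_sum (fun i : Fin k => (Finset.univ : Finset (Fin (n i))))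
      fun i b => U i b j * U i b l
    rw [Fintype.piFinset_univ] at h
    rw [← h]
    simp only [(hU _).sum_mul]
    split_ifs <;> simp [Finset.prod_const, hk.ne']
  calc ∑ a, odTensor U x a ^ 2
      = ∑ a : (∀ i : Fin k, Fin (n i)), ∑ j, ∑ l,
          x j * x l * ∏ i, U i (a i) j * U i (a i) l := by
        refine Finset.sum_congr rfl fun a _ => ?_
        rw [odTensor, sq, Finset.sum_mul_sum]
        refine Finset.sum_congr rfl fun j _ => Finset.sum_congr rfl fun l _ => ?_
        rw [Finset.prod_mul_distrib]; ring
    _ = ∑ j, ∑ l, x j * x l * if j = l then 1 else 0 := by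
        rw [Finset.sum_comm]
        refine Finset.sum_congr rfl fun j _ => ?_
        rw [Finset.sum_comm]
        refine Finset.sum_congr rfl fun l _ => ?_
        rw [← Finset.mul_sum, hprod]
    _ = ∑ j, x j ^ 2 := by simp [sq]

theorem sum_mul_odTensor {r : ℕ} (A : Tensor n) (U : Factors n r) (x : Fin r → ℝ) :
    ∑ a, A a * odTensor U x a = ∑ j, x j * lam A U j := by
  simp only [odTensor, lam, contract, cols, Finset.mul_sum]
  rw [Finset.sum_comm]
  exact Finset.sum_congr rfl fun j _ => Finset.sum_congr rfl fun a _ => by ring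

theorem g_eq_of_stiefel {r : ℕ} (hk : 0 < k) (A : Tensor n) {z : Ambient n r}
    (hz : ∀ i, Stiefel (z.factors i)) :
    g A z = (1 / 2) * ((∑ a, A a ^ 2) - 2 * (∑ j, z.2 j * lam A z.factors j)
      + ∑ j, z.2 j ^ 2) := by
  rw [g, ← sum_mul_odTensor, ← sum_odTensor_sq hk hz, Finset.mul_sum (a := (2 : ℝ)),
    ← Finset.sum_sub_distrib, ← Finset.sum_add_distrib]
  congr 1
  exact Finset.sum_congr rfl fun a _ => by ring

theorem g_mk_lam {r : ℕ} (hk : 0 < k) (A : Tensor n) {U : Factors n r}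
    (hU : ∀ i, Stiefel (U i)) :
    g A (Ambient.mk U (lam A U)) = (1 / 2) * ((∑ a, A a ^ 2) - objective A U) := by
  rw [g_eq_of_stiefel hk A (z := Ambient.mk U (lam A U)) hU]
  have h1 : ∑ j, (Ambient.mk U (lam A U)).2 j * lam A (Ambient.mk U (lam A U)).factors j
      = objective A U := Finset.sum_congr rfl fun j _ => (sq _).symm
  have h2 : ∑ j, (Ambient.mk U (lam A U)).2 j ^ 2 = objective A U := rfl
  rw [h1, h2]; ring

/-- The squared Frobenius norm of a tuple of matrices. -/
def frobSq {r : ℕ} (U : Factors n r) : ℝ := ∑ i, ∑ a, ∑ j, U i a j ^ 2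

theorem frobSq_nonneg {r : ℕ} (U : Factors n r) : 0 ≤ frobSq U :=
  Finset.sum_nonneg fun _ _ => Finset.sum_nonneg fun _ _ => Finset.sum_nonneg fun _ _ => sq_nonneg _

theorem frobDist_eq {r : ℕ} (U W : Factors n r) : frobDist U W = √(frobSq (U - W)) := rfl

theorem frobSq_le_of_abs_le {r : ℕ} {U : Factors n r} {c : ℝ}
    (h : ∀ i a j, |U i a j| ≤ c) : frobSq U ≤ (∑ i, (n i : ℝ) * r) * c ^ 2 := by
  calc frobSq U ≤ ∑ i, ∑ _a : Fin (n i), ∑ _j : Fin r, c ^ 2 := by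
        refine Finset.sum_le_sum fun i _ => Finset.sum_le_sum fun a _ =>
          Finset.sum_le_sum fun j _ => ?_
        exact sq_le_sq' (neg_le_of_abs_le (h i a j)) (le_of_abs_le (h i a j))
    _ = _ := by simp [Finset.sum_mul, mul_assoc]

theorem sq_apply_le_frobSq {r : ℕ} (U : Factors n r) (i : Fin k) (a : Fin (n i)) (j : Fin r) :
    U i a j ^ 2 ≤ frobSq U := by
  have h1 : U i a j ^ 2 ≤ ∑ j, U i a j ^ 2 :=
    Finset.single_le_sum (f := fun j => U i a j ^ 2) (fun _ _ => sq_nonneg _) (Finset.mem_univ j)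
  have h2 : ∑ j, U i a j ^ 2 ≤ ∑ a, ∑ j, U i a j ^ 2 :=
    Finset.single_le_sum (f := fun a => ∑ j, U i a j ^ 2)
      (fun _ _ => Finset.sum_nonneg fun _ _ => sq_nonneg _) (Finset.mem_univ a)
  have h3 : ∑ a, ∑ j, U i a j ^ 2 ≤ frobSq U :=
    Finset.single_le_sum (f := fun i => ∑ a, ∑ j, U i a j ^ 2)
      (fun _ _ => Finset.sum_nonneg fun _ _ => Finset.sum_nonneg fun _ _ => sq_nonneg _)
      (Finset.mem_univ i)
  exact h1.trans (h2.trans h3)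

theorem abs_sum_mul_le {r : ℕ} (U W : Factors n r) :
    |∑ i, ∑ a, ∑ j, U i a j * W i a j| ≤ √(frobSq U * frobSq W) := by
  have h := Finset.sum_mul_sq_le_sq_mul_sq
    (Finset.univ : Finset (Σ i : Fin k, Fin (n i) × Fin r))
    (fun p => U p.1 p.2.1 p.2.2) (fun p => W p.1 p.2.1 p.2.2)
  simp only [Fintype.sum_sigma, Fintype.sum_prod_type] at h
  exact Real.abs_le_sqrt h

/-- Tangent vectors to the Stiefel manifold are orthogonal to `U P` for symmetric `P`. -/
theorem sum_mul_symm_eq_zero {m r : ℕ} {U T : Matrix (Fin m) (Fin r) ℝ}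
    {P : Matrix (Fin r) (Fin r) ℝ} (hP : P.IsSymm) (hT : Tᵀ * U + Uᵀ * T = 0) :
    ∑ a, ∑ j, (U * P) a j * T a j = 0 := by
  have h1 : ∑ a, ∑ j, (U * P) a j * T a j = (Tᵀ * (U * P)).trace := by
    simp only [Matrix.trace, Matrix.diag, Matrix.mul_apply (M := Tᵀ), Matrix.transpose_apply]
    rw [Finset.sum_comm]
    exact Finset.sum_congr rfl fun _ _ => Finset.sum_congr rfl fun _ _ => mul_comm _ _
  have h2 : (Tᵀ * (U * P)).trace = (Uᵀ * T * P).trace := by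
    rw [← Matrix.trace_transpose, Matrix.transpose_mul, Matrix.transpose_mul, hP.eq,
      Matrix.transpose_transpose, Matrix.mul_assoc, Matrix.trace_mul_comm]
  have h3 : (Tᵀ * (U * P)).trace + (Uᵀ * T * P).trace = 0 := by
    rw [← Matrix.mul_assoc, ← Matrix.trace_add, ← Matrix.add_mul, hT, Matrix.zero_mul,
      Matrix.trace_zero]
  rw [h1]; linarith

/-- Differentiate the constant Gram matrix `UᵀU = 1` along the curve. -/
theorem tangent_of_hasDerivAt {m r : ℕ} {U : ℝ → Matrix (Fin m) (Fin r) ℝ}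
    {T : Matrix (Fin m) (Fin r) ℝ} {t : ℝ}
    (hU : ∀ a j, HasDerivAt (fun t => U t a j) (T a j) t) (hS : ∀ᶠ t' in 𝓝 t, Stiefel (U t')) :
    Tᵀ * U t + (U t)ᵀ * T = 0 := by
  ext j l
  have h1 : HasDerivAt (fun t => ∑ b, U t b j * U t b l)
      (∑ b, (T b j * U t b l + U t b j * T b l)) t :=
    HasDerivAt.fun_sum fun b _ => (hU b j).mul (hU b l)
  have h2 : HasDerivAt (fun t => ∑ b, U t b j * U t b l) 0 t :=
    (hasDerivAt_const t (if j = l then (1 : ℝ) else 0)).congr_of_eventuallyEq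
      (hS.mono fun t' ht' => ht'.sum_mul j l)
  have := h1.unique h2
  simpa [Matrix.mul_apply, Finset.sum_add_distrib] using this

/-- The directional derivative of `g` along a curve in the manifold, at a point `(𝕌, λ(𝕌))`. -/
theorem hasDerivAt_g_curve {r : ℕ} (hk : 0 < k) (A : Tensor n) {γ : ℝ → Ambient n r}
    {γ' : Ambient n r} {t : ℝ} (hγ : HasDerivAt γ γ' t)
    (hS : ∀ᶠ t' in 𝓝 t, ∀ i, Stiefel ((γ t').factors i))
    (hx : (γ t).2 = lam A (γ t).factors) {P : ∀ _ : Fin k, Matrix (Fin r) (Fin r) ℝ}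
    (hP : ∀ i, (P i).IsSymm) :
    HasDerivAt (fun t => g A (γ t))
      (-∑ i, ∑ a, ∑ j, (vLam A (γ t).factors i - (γ t).factors i * P i) a j * γ'.1 i a j) t := by
  have h1 : ∀ i a j, HasDerivAt (fun t => (γ t).factors i a j) (γ'.1 i a j) t := by
    intro i a j
    have h := (((ContinuousLinearMap.fst ℝ _ _).hasFDerivAt).comp_hasDerivAt t hγ)
    exact hasDerivAt_pi.1 (hasDerivAt_pi.1 (hasDerivAt_pi.1 h i) a) j
  have h2 : ∀ j, HasDerivAt (fun t => (γ t).2 j) (γ'.2 j) t := by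
    intro j
    have h := (((ContinuousLinearMap.snd ℝ _ _).hasFDerivAt).comp_hasDerivAt t hγ)
    exact hasDerivAt_pi.1 h j
  have h3 : ∀ j, HasDerivAt (fun t => lam A (γ t).factors j)
      (∑ i, ∑ b, contractExcept A i (cols (γ t).factors j) b * γ'.1 i b j) t := fun j =>
    hasDerivAt_contract A (x := fun t => cols (γ t).factors j)
      (x' := fun i b => γ'.1 i b j) fun i b => h1 i b j
  have h4 := (((HasDerivAt.fun_sum (u := Finset.univ)
    fun j _ => (h2 j).mul (h3 j)).const_mul 2).const_sub (∑ a, A a ^ 2)).add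
      (HasDerivAt.fun_sum (u := Finset.univ) fun j _ => (h2 j).pow 2)
  have h5 := (h4.const_mul (1 / 2 : ℝ)).congr_of_eventuallyEq (f₁ := fun t => g A (γ t))
    (hS.mono fun t' ht' => g_eq_of_stiefel hk A ht')
  refine h5.congr_deriv ?_
  -- The velocity is tangent to the Stiefel manifold, so the multiplier terms `U P` contribute
  -- nothing and can be inserted freely.
  have h6 : ∀ i, ∑ a, ∑ j, ((γ t).factors i * P i) a j * γ'.1 i a j = 0 := fun i =>
    sum_mul_symm_eq_zero (T := Matrix.of (γ'.1 i)) (hP i)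
      (tangent_of_hasDerivAt (U := fun t => (γ t).factors i) (h1 i) (hS.mono fun _ h => h i))
  have h7 : ∑ i, ∑ a, ∑ j, (vLam A (γ t).factors i - (γ t).factors i * P i) a j * γ'.1 i a j
      = ∑ j, lam A (γ t).factors j *
          ∑ i, ∑ b, contractExcept A i (cols (γ t).factors j) b * γ'.1 i b j := by
    simp only [Matrix.sub_apply, sub_mul, Finset.sum_sub_distrib, h6, sub_zero, vLam_apply,
      Finset.mul_sum]
    rw [Finset.sum_comm (s := (Finset.univ : Finset (Fin r)))]
    refine Finset.sum_congr rfl fun i _ => ?_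
    rw [Finset.sum_comm]
    exact Finset.sum_congr rfl fun _ _ => Finset.sum_congr rfl fun _ _ => by ring
  -- Because `x = λ(𝕌)` at this point, the terms containing the velocity of `x` cancel: `g` is
  -- stationary in `x` there.
  have h8 : ∑ j, ((2 : ℕ) : ℝ) * (γ t).2 j ^ (2 - 1) * γ'.2 j
      = 2 * ∑ j, γ'.2 j * lam A (γ t).factors j := by
    rw [Finset.mul_sum, hx]
    exact Finset.sum_congr rfl fun j _ => by push_cast; ring
  rw [h7, h8, Finset.sum_add_distrib, hx]
  ring

theorem IsLocalParametrization.mem {E : Type*} [NormedAddCommGroup E] [NormedSpace ℝ E] {d : ℕ}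
    {M : Set E} {Ω : Set (EuclideanSpace ℝ (Fin d))} {ψ : EuclideanSpace ℝ (Fin d) → E}
    (hψ : IsLocalParametrization M Ω ψ) {y : EuclideanSpace ℝ (Fin d)} (hy : y ∈ Ω) : ψ y ∈ M := by
  obtain ⟨O, -, hO⟩ := hψ.isOpen_image Ω subset_rfl hψ.isOpen_source
  exact (hO ▸ Set.mem_image_of_mem ψ hy : ψ y ∈ M ∩ O).1

/-- A local parametrization covers a neighbourhood in `M` with parameters close to the given one. -/
theorem IsLocalParametrization.eventually_exists {E : Type*} [NormedAddCommGroup E]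
    [NormedSpace ℝ E] {d : ℕ} {M : Set E} {Ω : Set (EuclideanSpace ℝ (Fin d))}
    {ψ : EuclideanSpace ℝ (Fin d) → E} (hψ : IsLocalParametrization M Ω ψ)
    {y : EuclideanSpace ℝ (Fin d)} (hy : y ∈ Ω) {p : EuclideanSpace ℝ (Fin d) → Prop}
    (hp : ∀ᶠ y' in 𝓝 y, p y') :
    ∀ᶠ z in 𝓝 (ψ y), z ∈ M → ∃ y' ∈ Ω, p y' ∧ ψ y' = z := by
  obtain ⟨W, hW, hWo, hyW⟩ := eventually_nhds_iff.1 (hp.and (hψ.isOpen_source.mem_nhds hy))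
  obtain ⟨O, hOo, hO⟩ := hψ.isOpen_image W (fun y' hy' => (hW y' hy').2) hWo
  have hyO : ψ y ∈ O := (hO ▸ Set.mem_image_of_mem ψ hyW : ψ y ∈ M ∩ O).2
  filter_upwards [hOo.mem_nhds hyO] with z hzO hzM
  obtain ⟨y', hy', rfl⟩ : z ∈ ψ '' W := hO ▸ ⟨hzM, hzO⟩
  exact ⟨y', (hW y' hy').2, (hW y' hy').1, rfl⟩

theorem contDiff_g {r : ℕ} (A : Tensor n) : ContDiff ℝ ∞ (g (r := r) A) := by
  have h : ∀ (i : Fin k) (b : Fin (n i)) (j : Fin r),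
      ContDiff ℝ ∞ fun z : Ambient n r => z.1 i b j := fun i b j =>
    contDiff_pi.1 (contDiff_pi.1 (contDiff_pi.1 contDiff_fst i) b) j
  refine contDiff_const.mul (ContDiff.sum fun a _ => ?_)
  refine (contDiff_const.sub (ContDiff.sum fun j _ => ContDiff.mul ?_ ?_)).pow 2
  · fun_prop
  · exact contDiff_prod fun i _ => h i (a i) j

theorem contDiff_lam {r : ℕ} (A : Tensor n) (j : Fin r) :
    ContDiff ℝ 1 (fun U : ∀ i : Fin k, Fin (n i) → Fin r → ℝ => lam A (r := r) U j) := by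
  have h : ∀ (i : Fin k) (b : Fin (n i)), ContDiff ℝ 1
      fun U : ∀ i : Fin k, Fin (n i) → Fin r → ℝ => U i b j := fun i b =>
    contDiff_pi.1 (contDiff_pi.1 (contDiff_pi.1 contDiff_id i) b) j
  exact ContDiff.sum fun a _ => contDiff_const.mul (contDiff_prod fun i _ => h i (a i))

theorem contDiff_vLam {r : ℕ} (A : Tensor n) :
    ContDiff ℝ 1 (fun (U : ∀ i : Fin k, Fin (n i) → Fin r → ℝ) (i : Fin k) (b : Fin (n i))
      (j : Fin r) => vLam A (r := r) U i b j) := by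
  refine contDiff_pi.2 fun i => contDiff_pi.2 fun b => contDiff_pi.2 fun j => ?_
  have h : ∀ (i : Fin k) (b : Fin (n i)), ContDiff ℝ 1
      fun U : ∀ i : Fin k, Fin (n i) → Fin r → ℝ => U i b j := fun i b =>
    contDiff_pi.1 (contDiff_pi.1 (contDiff_pi.1 contDiff_id i) b) j
  have heq : (fun U : ∀ i : Fin k, Fin (n i) → Fin r → ℝ => vLam A (r := r) U i b j)
      = fun U => contractExcept A i (cols (r := r) U j) b * lam A (r := r) U j :=
    funext fun U => vLam_apply A U i b j
  rw [heq]
  refine ContDiff.mul (ContDiff.sum fun a _ => ?_) (contDiff_lam A j)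
  split_ifs
  · exact contDiff_const.mul (contDiff_prod fun l _ => h l (a l))
  · exact contDiff_const

theorem continuous_mk_lam {r : ℕ} (A : Tensor n) :
    Continuous (fun U : Factors n r => Ambient.mk U (lam A U)) :=
  continuous_id.prodMk (continuous_pi fun j => (contDiff_lam A j).continuous)

theorem abs_apply_le_norm {r : ℕ} (X : ∀ i : Fin k, Fin (n i) → Fin r → ℝ) (i : Fin k)
    (a : Fin (n i)) (j : Fin r) : |X i a j| ≤ ‖X‖ :=
  (norm_le_pi_norm (X i a) j).trans ((norm_le_pi_norm (X i) a).trans (norm_le_pi_norm X i))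

/-- Near a nondegenerate KKT point the objective gap is bounded by the squared KKT residual. -/
theorem objective_gap_le {s : ℕ} (hk : 0 < k) {A : Tensor n} {Ustar : Factors n s}
    (hstar : IsNondegenerateKKT A Ustar) :
    ∃ C : ℝ, 0 < C ∧ ∀ᶠ U in 𝓝 Ustar, (∀ i, Stiefel (U i)) →
      ∀ P : Fin k → Matrix (Fin s) (Fin s) ℝ, (∀ i, (P i).IsSymm) →
        objective A Ustar - objective A U ≤ C * frobSq (fun i => vLam A U i - U i * P i) := by
  obtain ⟨-, ⟨hSstar, hne⟩, d, Ω, ψ, y, hψ, hy, hψy, hcrit, hnd⟩ := hstar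
  have hψat : ∀ y' ∈ Ω, ContDiffAt ℝ ∞ ψ y' := fun y' hy' =>
    hψ.smooth.contDiffAt (hψ.isOpen_source.mem_nhds hy')
  have hhat : ∀ y' ∈ Ω, ContDiffAt ℝ ∞ (g A ∘ ψ) y' := fun y' hy' =>
    (contDiff_g A).contDiffAt.comp y' (hψat y' hy')
  obtain ⟨C, hC, hloja⟩ := abs_sub_le_sq_norm_fderiv
    ((hhat y hy).of_le (WithTop.coe_le_coe.2 le_top)) hcrit hnd
  set L : ℝ := ‖fderiv ℝ ψ y‖ + 1 with hL
  have hL0 : 0 < L := by positivity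
  have hbound : ∀ᶠ y' in 𝓝 y, ‖fderiv ℝ ψ y'‖ < L :=
    (((hψat y hy).continuousAt_fderiv (by simp)).norm).eventually_lt_const (by rw [hL]; linarith)
  set N : ℝ := ∑ i, (n i : ℝ) * s
  have hN0 : 0 ≤ N := Finset.sum_nonneg fun _ _ => by positivity
  refine ⟨2 * C * (N * L ^ 2 + 1), by positivity, ?_⟩
  have hev := hψ.eventually_exists hy (hloja.and hbound)
  rw [hψy] at hev
  -- Nonvanishing of the coefficients is an open condition, so `(𝕌, λ(𝕌))` remains on the manifold
  -- and is reached by the chart.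
  have hlam : ∀ᶠ z : Ambient n s in 𝓝 (Ambient.mk Ustar (lam A Ustar)), ∀ j, z.2 j ≠ 0 :=
    eventually_all.2 fun j =>
      ((continuous_apply j).comp continuous_snd).continuousAt.eventually_ne (hne j)
  filter_upwards [(continuous_mk_lam A).continuousAt.eventually (hev.and hlam)]
    with U hU hSU P hP
  obtain ⟨y', hy', ⟨hgap, hLy'⟩, hz⟩ := hU.1 ⟨hSU, hU.2⟩
  set R : Factors n s := fun i => vLam A U i - U i * P i with hR
  -- The differential in the chart is computed along straight lines in the parameters; the curve
  -- formula and Cauchy–Schwarz then bound it by the residual.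
  have hderiv : ∀ w, |fderiv ℝ (g A ∘ ψ) y' w| ≤ √(frobSq R * N) * L * ‖w‖ := by
    intro w
    have hline : HasDerivAt (fun t : ℝ => y' + t • w) w 0 := by
      simpa using ((hasDerivAt_id (0 : ℝ)).smul_const w).const_add y'
    have hγ : HasDerivAt (fun t : ℝ => ψ (y' + t • w)) (fderiv ℝ ψ y' w) 0 := by
      refine HasFDerivAt.comp_hasDerivAt (0 : ℝ) (f := fun t : ℝ => y' + t • w) ?_ hline
      simpa using ((hψat y' hy').differentiableAt (by simp)).hasFDerivAt
    have hgγ : HasDerivAt (fun t : ℝ => g A (ψ (y' + t • w))) (fderiv ℝ (g A ∘ ψ) y' w) 0 := by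
      refine HasFDerivAt.comp_hasDerivAt (l := g A ∘ ψ) (0 : ℝ)
        (f := fun t : ℝ => y' + t • w) ?_ hline
      simpa using ((hhat y' hy').differentiableAt (by simp)).hasFDerivAt
    have hmem : ∀ᶠ t : ℝ in 𝓝 0, ∀ i, Stiefel ((ψ (y' + t • w)).factors i) := by
      have : ∀ᶠ t : ℝ in 𝓝 0, y' + t • w ∈ Ω :=
        hline.continuousAt.eventually (hψ.isOpen_source.mem_nhds (by simpa using hy'))
      exact this.mono fun t ht => (hψ.mem ht).1
    have hγ0 : ψ (y' + (0 : ℝ) • w) = Ambient.mk U (lam A U) := by simpa using hz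
    have hg' := hasDerivAt_g_curve hk A hγ hmem (by rw [hγ0]; rfl) hP
    rw [hγ0] at hg'
    rw [hgγ.unique hg', abs_neg]
    have hent : ∀ i a j, |(fderiv ℝ ψ y' w).1 i a j| ≤ L * ‖w‖ := fun i a j =>
      (abs_apply_le_norm _ i a j).trans
        ((norm_fst_le _).trans ((fderiv ℝ ψ y').le_of_opNorm_le hLy'.le w))
    refine (abs_sum_mul_le R (fderiv ℝ ψ y' w).1).trans ?_
    have h1 := frobSq_le_of_abs_le (r := s) (U := (fderiv ℝ ψ y' w).1) hent
    have h2 := frobSq_nonneg R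
    calc √(frobSq R * frobSq (r := s) (fderiv ℝ ψ y' w).1)
        ≤ √(frobSq R * (N * (L * ‖w‖) ^ 2)) := Real.sqrt_le_sqrt (by gcongr)
      _ = √(frobSq R * N) * L * ‖w‖ := by
        rw [← mul_assoc, Real.sqrt_mul (by positivity), Real.sqrt_sq (by positivity), mul_assoc]
  have hnorm : ‖fderiv ℝ (g A ∘ ψ) y'‖ ^ 2 ≤ frobSq R * N * L ^ 2 := by
    have h2 := frobSq_nonneg R
    have := ContinuousLinearMap.opNorm_le_bound (fderiv ℝ (g A ∘ ψ) y')
      (M := √(frobSq R * N) * L) (by positivity) hderiv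
    calc ‖fderiv ℝ (g A ∘ ψ) y'‖ ^ 2 ≤ (√(frobSq R * N) * L) ^ 2 := by gcongr
      _ = _ := by rw [mul_pow, Real.sq_sqrt (by positivity)]
  have hgapeq : objective A Ustar - objective A U = 2 * ((g A ∘ ψ) y' - (g A ∘ ψ) y) := by
    simp only [Function.comp, hz, hψy, g_mk_lam hk A hSU, g_mk_lam hk A (U := Ustar) hSstar]
    ring
  have h2 := frobSq_nonneg R
  calc objective A Ustar - objective A U
      ≤ 2 * |(g A ∘ ψ) y' - (g A ∘ ψ) y| := by rw [hgapeq]; gcongr; exact le_abs_self _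
    _ ≤ 2 * (C * (frobSq R * N * L ^ 2)) := by
        gcongr; exact hgap.trans (by gcongr)
    -- The added `1` only keeps the constant positive when `N = 0`.
    _ ≤ 2 * C * (N * L ^ 2 + 1) * frobSq R := by
        have : 0 ≤ C * frobSq R := by positivity
        nlinarith

/-! ### One sweep of the algorithm -/

theorem IsFactorUpdate.stiefel {m r : ℕ} {ε : ℝ} {B U U' : Matrix (Fin m) (Fin r) ℝ}
    (h : IsFactorUpdate ε B U U') : Stiefel U' := by
  obtain ⟨G, σ, H, hsvd, ⟨-, rfl⟩ | ⟨-, S, hS⟩⟩ := h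
  · have h1 : Gᵀ * G = 1 := hsvd.left_orth
    have h2 : H * Hᵀ = 1 := mul_eq_one_comm.1 hsvd.right_orth
    rw [Stiefel, Matrix.transpose_mul, Matrix.transpose_transpose, Matrix.mul_assoc,
      ← Matrix.mul_assoc Gᵀ, h1, Matrix.one_mul, h2]
  · exact hS.orth

/-- The polar decompositions behind the two branches of the update. -/
theorem IsFactorUpdate.exists_posSemidef {m r : ℕ} {ε : ℝ} {B U U' : Matrix (Fin m) (Fin r) ℝ}
    (h : IsFactorUpdate ε B U U') :
    ∃ S : Matrix (Fin r) (Fin r) ℝ, S.PosSemidef ∧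
      (B = U' * (S + ε • 1) ∨ B = U' * S - ε • U) := by
  obtain ⟨G, σ, H, hsvd, ⟨hσ, rfl⟩ | ⟨-, S, hS⟩⟩ := h
  -- All singular values are at least `ε`, so subtracting `ε` from them leaves a positive
  -- semidefinite polar factor.
  · refine ⟨H * Matrix.diagonal (fun j => σ j - ε) * Hᵀ, ?_, Or.inl ?_⟩
    · have := (Matrix.PosSemidef.diagonal (R := ℝ) (d := fun j => σ j - ε)
        fun j => sub_nonneg.2 (hσ j)).mul_mul_conjTranspose_same H
      rwa [Matrix.conjTranspose_eq_transpose_of_trivial] at this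
    · have h1 : Hᵀ * H = 1 := hsvd.right_orth
      have h2 : H * Hᵀ = 1 := mul_eq_one_comm.1 h1
      have h3 : Matrix.diagonal σ = Matrix.diagonal (fun j => σ j - ε) + ε • 1 := by
        rw [Matrix.smul_one_eq_diagonal, Matrix.diagonal_add]; simp
      rw [hsvd.eq, h3, Matrix.mul_add, Matrix.mul_add, Matrix.add_mul]
      simp only [Matrix.mul_smul, Matrix.smul_mul, Matrix.mul_one]
      rw [Matrix.mul_assoc G Hᵀ, ← Matrix.mul_assoc Hᵀ, ← Matrix.mul_assoc Hᵀ, h1, Matrix.one_mul,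
        Matrix.mul_assoc]
  · exact ⟨S, hS.posSemidef, Or.inr (eq_sub_of_add_eq hS.eq)⟩

theorem sum_mul_eq_trace {m r : ℕ} (X Y : Matrix (Fin m) (Fin r) ℝ) :
    ∑ a, ∑ j, X a j * Y a j = (Yᵀ * X).trace := by
  simp only [Matrix.trace, Matrix.diag, Matrix.mul_apply, Matrix.transpose_apply]
  rw [Finset.sum_comm]
  exact Finset.sum_congr rfl fun _ _ => Finset.sum_congr rfl fun _ _ => mul_comm _ _

theorem _root_.Matrix.PosSemidef.isSymm {r : ℕ} {S : Matrix (Fin r) (Fin r) ℝ}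
    (hS : S.PosSemidef) : S.IsSymm := by
  have := hS.isHermitian.eq
  rwa [Matrix.conjTranspose_eq_transpose_of_trivial] at this

/-- Orthonormality gives `(U' - U)ᵀ(U' - U) = 2 - U'ᵀU - UᵀU'`, and the two cross terms have equal
trace against a symmetric `S`. -/
theorem Stiefel.trace_eq {m r : ℕ} {U U' : Matrix (Fin m) (Fin r) ℝ} (hU : Stiefel U)
    (hU' : Stiefel U') {S : Matrix (Fin r) (Fin r) ℝ} (hS : S.IsSymm) :
    2 * ((U' - U)ᵀ * (U' * S)).trace = ((U' - U) * S * (U' - U)ᵀ).trace := by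
  have h1 : U'ᵀ * U' = 1 := hU'
  have h2 : Uᵀ * U = 1 := hU
  have h3 : ((U' - U) * S * (U' - U)ᵀ).trace = ((U' - U)ᵀ * (U' - U) * S).trace := by
    rw [Matrix.trace_mul_comm, Matrix.mul_assoc]
  have h4 : (U'ᵀ * U * S).trace = (Uᵀ * U' * S).trace := by
    rw [← Matrix.trace_transpose, Matrix.transpose_mul, Matrix.transpose_mul, hS.eq,
      Matrix.transpose_transpose, Matrix.trace_mul_comm]
  rw [h3, ← Matrix.mul_assoc]
  simp only [Matrix.transpose_sub, Matrix.sub_mul, Matrix.mul_sub, Matrix.trace_sub, h1, h2, h4]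
  ring

theorem Stiefel.trace_nonneg {m r : ℕ} {U U' : Matrix (Fin m) (Fin r) ℝ} (hU : Stiefel U)
    (hU' : Stiefel U') {S : Matrix (Fin r) (Fin r) ℝ} (hS : S.PosSemidef) :
    0 ≤ ((U' - U)ᵀ * (U' * S)).trace := by
  have h1 := hU.trace_eq hU' (S := S) hS.isSymm
  have h2 := (hS.mul_mul_conjTranspose_same (U' - U)).trace_nonneg
  rw [Matrix.conjTranspose_eq_transpose_of_trivial] at h2
  linarith

/-- The update increases the linearized objective. -/
theorem IsFactorUpdate.increase {m r : ℕ} {ε : ℝ} {B U U' : Matrix (Fin m) (Fin r) ℝ}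
    (h : IsFactorUpdate ε B U U') (hU : Stiefel U) :
    ε * ∑ a, ∑ j, (U' - U) a j ^ 2 ≤ 2 * ∑ a, ∑ j, B a j * (U' - U) a j := by
  have hU' := h.stiefel
  have h1 : U'ᵀ * U' = 1 := hU'
  have h2 : Uᵀ * U = 1 := hU
  have hsq : ∑ a, ∑ j, (U' - U) a j ^ 2 = ((U' - U)ᵀ * (U' - U)).trace := by
    simp only [sq]; exact sum_mul_eq_trace _ _
  have h3 := hU.trace_eq hU' (S := 1) (by simp)
  rw [Matrix.mul_one, Matrix.mul_one, Matrix.trace_mul_comm (U' - U)] at h3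
  rw [sum_mul_eq_trace, hsq]
  -- With `Δ = U' - U`, orthonormality gives `2⟨U', Δ⟩ = ‖Δ‖²` and `-2⟨U, Δ⟩ = ‖Δ‖²`. So both `+εU'`
  -- and `-εU` contribute exactly `ε‖Δ‖²`, while the part `U'S` contributes a nonnegative amount.
  obtain ⟨S, hS, rfl | rfl⟩ := h.exists_posSemidef
  · have h4 := hU.trace_nonneg hU' hS
    simp only [Matrix.mul_add, Matrix.mul_smul, Matrix.mul_one, Matrix.trace_add,
      Matrix.trace_smul, smul_eq_mul] at h4 ⊢
    linear_combination 2 * h4 - ε * h3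
  · have h4 := hU.trace_nonneg hU' hS
    have h5 : ((U' - U)ᵀ * (U' - U)).trace = ((U' - U)ᵀ * U').trace - ((U' - U)ᵀ * U).trace := by
      rw [Matrix.mul_sub, Matrix.trace_sub]
    rw [Matrix.mul_sub _ (U' * S), Matrix.trace_sub, Matrix.mul_smul, Matrix.trace_smul,
      smul_eq_mul]
    linear_combination 2 * h4 + ε * h3 + 2 * ε * h5

/-- The KKT residual of the update is controlled by the step. -/
theorem IsFactorUpdate.exists_residual {m r : ℕ} {ε : ℝ} (hε : 0 ≤ ε)
    {B U U' : Matrix (Fin m) (Fin r) ℝ} (h : IsFactorUpdate ε B U U') :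
    ∃ P : Matrix (Fin r) (Fin r) ℝ, P.IsSymm ∧
      ∀ a j, |(B - U' * P) a j| ≤ ε * |(U' - U) a j| := by
  obtain ⟨S, hS, rfl | rfl⟩ := h.exists_posSemidef
  · refine ⟨S + ε • 1, ?_, fun a j => ?_⟩
    · have : S.IsSymm := hS.isSymm
      exact this.add (by simp [Matrix.IsSymm])
    · simp only [sub_self, Matrix.zero_apply, abs_zero]; positivity
  · refine ⟨S - ε • 1, ?_, fun a j => ?_⟩
    · have : S.IsSymm := hS.isSymm
      exact this.sub (by simp [Matrix.IsSymm])
    · have : U' * S - ε • U - U' * (S - ε • 1) = ε • (U' - U) := by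
        rw [Matrix.mul_sub, Matrix.mul_smul, Matrix.mul_one, smul_sub]; abel
      rw [this, Matrix.smul_apply, smul_eq_mul, abs_mul, abs_of_nonneg hε]

theorem contractExcept_congr (A : Tensor n) (i : Fin k) {x y : ∀ i : Fin k, Fin (n i) → ℝ}
    (h : ∀ l, l ≠ i → x l = y l) : contractExcept A i x = contractExcept A i y := by
  funext b
  refine Finset.sum_congr rfl fun a _ => ?_
  rw [Finset.prod_congr rfl fun l hl => by rw [h l (Finset.ne_of_mem_erase hl)]]

/-- The objective is convex quadratic in each factor. -/
theorem two_mul_vLam_le_objective_sub {r : ℕ} (A : Tensor n) (i : Fin k) {W W' : Factors n r}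
    (h : ∀ l, l ≠ i → W l = W' l) :
    2 * ∑ a, ∑ j, vLam A W i a j * (W' i - W i) a j ≤ objective A W' - objective A W := by
  -- Each `λ_j` is linear in the `i`-th factor; the claim then reduces to `2a(b - a) ≤ b² - a²`.
  have hlam : ∀ j, lam A W' j - lam A W j
      = ∑ a, contractExcept A i (cols W j) a * (W' i - W i) a j := by
    intro j
    have h1 : contractExcept A i (cols W' j) = contractExcept A i (cols W j) :=
      contractExcept_congr A i fun l hl => by
        funext a; change W' l a j = W l a j; rw [h l hl]
    simp only [lam, Matrix.sub_apply, mul_sub, Finset.sum_sub_distrib]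
    rw [← sum_contractExcept_mul A i (cols W' j), ← sum_contractExcept_mul A i (cols W j), h1]
    rfl
  have h2 : ∑ a, ∑ j, vLam A W i a j * (W' i - W i) a j
      = ∑ j, lam A W j * (lam A W' j - lam A W j) := by
    rw [Finset.sum_comm]
    refine Finset.sum_congr rfl fun j _ => ?_
    rw [hlam, Finset.mul_sum]
    exact Finset.sum_congr rfl fun a _ => by rw [vLam_apply]; ring
  rw [h2, objective, objective, Finset.mul_sum, ← Finset.sum_sub_distrib]
  refine Finset.sum_le_sum fun j _ => ?_
  nlinarith [sq_nonneg (lam A W' j - lam A W j)]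

/-- The first `m` factors of `U'` and the others of `U`. -/
def partialSweep {r : ℕ} (U U' : Factors n r) (m : ℕ) : Factors n r :=
  fun l => if (l : ℕ) < m then U' l else U l

/-- The gains of the single factor updates telescope along the partially updated tuples. -/
theorem IsSweep.increase {r : ℕ} {A : Tensor n} {ε : ℝ} {U U' : Factors n r}
    (h : IsSweep A ε U U') (hU : ∀ i, Stiefel (U i)) :
    ε * frobSq (U' - U) ≤ objective A U' - objective A U := by
  have hstep : ∀ i : Fin k, ε * ∑ a, ∑ j, (U' i - U i) a j ^ 2 ≤
      objective A (partialSweep U U' (i + 1)) - objective A (partialSweep U U' i) := by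
    intro i
    have h0 : mixed U U' i = partialSweep U U' i := rfl
    have h1 := two_mul_vLam_le_objective_sub A i (W := partialSweep U U' i)
      (W' := partialSweep U U' (i + 1)) fun l hl => by
        have : (l : ℕ) ≠ i := fun h => hl (Fin.ext h)
        have : (l : ℕ) < i ↔ (l : ℕ) < i + 1 := by omega
        simp only [partialSweep, this]
    have h2 : partialSweep U U' (i + 1) i = U' i := by simp [partialSweep]
    have h3 : partialSweep U U' i i = U i := by simp [partialSweep]
    rw [h2, h3] at h1
    exact ((h i).increase (hU i)).trans h1
  have htel : ∑ i : Fin k, (objective A (partialSweep U U' (i + 1))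
      - objective A (partialSweep U U' i)) = objective A U' - objective A U := by
    rw [Fin.sum_univ_eq_sum_range (fun m => objective A (partialSweep U U' (m + 1))
      - objective A (partialSweep U U' m)) k, Finset.sum_range_sub
        (fun m => objective A (partialSweep U U' m))]
    have h1 : partialSweep U U' k = U' := by funext l; simp [partialSweep]
    have h2 : partialSweep U U' 0 = U := by funext l; simp [partialSweep]
    rw [h1, h2]
  rw [← htel, frobSq, Finset.mul_sum]
  exact Finset.sum_le_sum fun i _ => hstep i

theorem norm_le_sqrt_frobSq {r : ℕ} {X : ∀ i : Fin k, Fin (n i) → Fin r → ℝ} {D : Factors n r}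
    (h : ∀ i a j, |X i a j| ≤ |D i a j|) : ‖X‖ ≤ √(frobSq D) :=
  (pi_norm_le_iff_of_nonneg (Real.sqrt_nonneg _)).2 fun i =>
    (pi_norm_le_iff_of_nonneg (Real.sqrt_nonneg _)).2 fun a =>
      (pi_norm_le_iff_of_nonneg (Real.sqrt_nonneg _)).2 fun j =>
        (h i a j).trans (Real.abs_le_sqrt (sq_apply_le_frobSq D i a j))

/-- The KKT residual after a sweep is controlled by the step. -/
theorem exists_residual_le {r : ℕ} (A : Tensor n) {ε : ℝ} (hε : 0 ≤ ε) (Ustar : Factors n r) :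
    ∃ C : ℝ, 0 ≤ C ∧ ∀ᶠ p : Factors n r × Factors n r in 𝓝 (Ustar, Ustar),
      IsSweep A ε p.1 p.2 →
        ∃ P : Fin k → Matrix (Fin r) (Fin r) ℝ, (∀ i, (P i).IsSymm) ∧
          frobSq (fun i => vLam A p.2 i - p.2 i * P i) ≤ C * frobSq (p.2 - p.1) := by
  have hlip := fun x : (∀ i : Fin k, Fin (n i) → Fin r → ℝ) =>
    ContDiffAt.exists_lipschitzOnWith ((contDiff_vLam (r := r) A).contDiffAt (x := x))
  obtain ⟨K, t, ht, hK⟩ := hlip Ustar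
  have ht' : ∀ᶠ U : Factors n r in 𝓝 Ustar, U ∈ t := ht
  have hmix : ∀ i, ∀ᶠ p : Factors n r × Factors n r in 𝓝 (Ustar, Ustar), mixed p.1 p.2 i ∈ t := by
    intro i
    have hc : Continuous fun p : Factors n r × Factors n r => mixed p.1 p.2 i := by
      refine continuous_pi fun l => ?_
      unfold mixed
      split_ifs
      · exact (continuous_apply l).comp continuous_snd
      · exact (continuous_apply l).comp continuous_fst
    have h0 : mixed Ustar Ustar i = Ustar := by funext l; simp [mixed]
    refine hc.continuousAt.eventually ?_
    simp only [h0]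
    exact ht'
  set N : ℝ := ∑ i, (n i : ℝ) * r
  have hN0 : 0 ≤ N := Finset.sum_nonneg fun _ _ => by positivity
  refine ⟨N * (K + ε) ^ 2, by positivity, ?_⟩
  filter_upwards [eventually_all.2 hmix, continuous_snd.continuousAt.eventually ht']
  rintro ⟨U, U'⟩ hmixt hU't hsw
  simp only at hmixt hU't hsw ⊢
  choose P hP hres using fun i => (hsw i).exists_residual hε
  refine ⟨P, hP, ?_⟩
  have hent : ∀ i a j, |(vLam A U' i - U' i * P i) a j| ≤ (K + ε) * √(frobSq (U' - U)) := by
    intro i a j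
    -- The update of factor `i` is stationary for data taken at the mixed tuple; moving to the final
    -- tuple costs a local Lipschitz constant times the sweep length.
    have h1 : |vLam A U' i a j - vLam A (mixed U U' i) i a j| ≤ K * √(frobSq (U' - U)) := by
      have h := hK.norm_sub_le hU't (hmixt i)
      have h2 : ‖(fun l a j => U' l a j - mixed U U' i l a j :
          ∀ i : Fin k, Fin (n i) → Fin r → ℝ)‖ ≤ √(frobSq (U' - U)) := by
        refine norm_le_sqrt_frobSq fun l b m => ?_
        unfold mixed
        split_ifs
        · simp
        · rfl
      refine le_trans ?_ (h.trans (mul_le_mul_of_nonneg_left h2 K.2))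
      exact abs_apply_le_norm (fun l a j => vLam A U' l a j - vLam A (mixed U U' i) l a j) i a j
    have h3 : |(U' - U) i a j| ≤ √(frobSq (U' - U)) :=
      Real.abs_le_sqrt (sq_apply_le_frobSq (U' - U) i a j)
    calc |(vLam A U' i - U' i * P i) a j|
        = |(vLam A U' i a j - vLam A (mixed U U' i) i a j)
            + (vLam A (mixed U U' i) i - U' i * P i) a j| := by
          rw [Matrix.sub_apply, Matrix.sub_apply]; ring_nf
      _ ≤ K * √(frobSq (U' - U)) + ε * √(frobSq (U' - U)) :=
          (abs_add_le _ _).trans (add_le_add h1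
            ((hres i a j).trans (mul_le_mul_of_nonneg_left h3 hε)))
      _ = _ := by ring
  refine (frobSq_le_of_abs_le (U := fun i => vLam A U' i - U' i * P i) hent).trans_eq ?_
  rw [mul_pow, Real.sq_sqrt (frobSq_nonneg _), mul_assoc]

/-! ### Rates from a contraction inequality -/

/-- The tuple as a vector of a Euclidean space. -/
noncomputable def toEuclidean {r : ℕ} (U : Factors n r) :
    EuclideanSpace ℝ (Σ i : Fin k, Fin (n i) × Fin r) :=
  WithLp.toLp 2 fun p => U p.1 p.2.1 p.2.2

theorem frobDist_eq_dist {r : ℕ} (U W : Factors n r) :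
    frobDist U W = dist (toEuclidean U) (toEuclidean W) := by
  rw [EuclideanSpace.dist_eq]
  simp [frobDist, toEuclidean, Real.dist_eq, Fintype.sum_sigma, Fintype.sum_prod_type]

theorem tendsto_of_frobDist {r : ℕ} {V : ℕ → Factors n r} {Ustar : Factors n r}
    (h : Tendsto (fun m => frobDist (V m) Ustar) atTop (𝓝 0)) : Tendsto V atTop (𝓝 Ustar) := by
  refine tendsto_pi_nhds.2 fun i => tendsto_pi_nhds.2 fun a => tendsto_pi_nhds.2 fun j => ?_
  rw [tendsto_iff_dist_tendsto_zero]
  exact squeeze_zero (fun _ => dist_nonneg)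
    (fun m => Real.abs_le_sqrt (sq_apply_le_frobSq (V m - Ustar) i a j)) h

/-- Linear rates for a sequence of gaps and steps satisfying a sufficient decrease condition and
an error bound. -/
theorem linear_rates {a D : ℕ → ℝ} {ε K : ℝ} (hε : 0 < ε) (hK : 0 < K) (hD : ∀ m, 0 ≤ D m)
    (hdec : ∀ m, ε * D m ≤ a m - a (m + 1)) (herr : ∀ m, a (m + 1) ≤ K * D m)
    (ha : Tendsto a atTop (𝓝 0)) :
    ∃ q, 0 < q ∧ q < 1 ∧ (∀ m, |a (m + 1)| ≤ q * |a m|) ∧ ∀ m, D m ≤ a 0 / ε * q ^ m := by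
  have hanti : Antitone a := antitone_nat_of_succ_le fun m => by
    nlinarith [hdec m, mul_nonneg hε.le (hD m)]
  have ha0 : ∀ m, 0 ≤ a m := fun m => hanti.le_of_tendsto ha m
  -- Eliminating `D m` gives `ε a (m+1) ≤ K (a m - a (m+1))`, whence the ratio `K / (K + ε)`.
  have hq : ∀ m, a (m + 1) ≤ K / (K + ε) * a m := fun m => by
    rw [div_mul_eq_mul_div, le_div_iff₀ (by positivity)]
    nlinarith [hdec m, herr m]
  have hpow : ∀ m, a m ≤ a 0 * (K / (K + ε)) ^ m := fun m => by
    induction m with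
    | zero => simp
    | succ m ih =>
      calc a (m + 1) ≤ K / (K + ε) * a m := hq m
        _ ≤ K / (K + ε) * (a 0 * (K / (K + ε)) ^ m) := by gcongr
        _ = _ := by ring
  refine ⟨K / (K + ε), by positivity, (div_lt_one (by positivity)).2 (by linarith), fun m => ?_,
    fun m => ?_⟩
  · rw [abs_of_nonneg (ha0 _), abs_of_nonneg (ha0 _)]; exact hq m
  · rw [div_mul_eq_mul_div, le_div_iff₀ hε]
    linarith [hdec m, hpow m, ha0 (m + 1)]

theorem continuous_objective {r : ℕ} (A : Tensor n) :
    Continuous (fun U : Factors n r => objective A U) :=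
  continuous_finsetSum _ fun j _ => (contDiff_lam A j).continuous.pow 2

/-- Linear convergence of a sequence of sweeps to a nondegenerate KKT point. -/
theorem sweeps_linear_rates {s : ℕ} (hk : 0 < k) {A : Tensor n} {ε : ℝ} (hε : 0 < ε)
    {V : ℕ → Factors n s} {Ustar : Factors n s} (hstar : IsNondegenerateKKT A Ustar)
    (hV : Tendsto V atTop (𝓝 Ustar)) (hS : ∀ m i, Stiefel (V m i))
    (hsw : ∀ m, IsSweep A ε (V m) (V (m + 1))) :
    ∃ N M q, 0 < q ∧ q < 1 ∧
      (∀ m ≥ N, |objective A (V (m + 1)) - objective A Ustar|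
        ≤ q * |objective A (V m) - objective A Ustar|) ∧
      ∀ m ≥ N, frobDist (V m) Ustar ≤ M * q ^ m := by
  obtain ⟨C₁, hC₁, hgap⟩ := objective_gap_le hk hstar
  obtain ⟨C₂, hC₂, hres⟩ := exists_residual_le A hε.le Ustar
  have hV1 : Tendsto (fun m => V (m + 1)) atTop (𝓝 Ustar) := (tendsto_add_atTop_iff_nat 1).2 hV
  have herr : ∀ᶠ m in atTop, objective A Ustar - objective A (V (m + 1))
      ≤ (C₁ * C₂ + 1) * frobSq (V (m + 1) - V m) := by
    filter_upwards [hV1.eventually hgap, (hV.prodMk_nhds hV1).eventually hres] with m h1 h2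
    obtain ⟨P, hP, hPres⟩ := h2 (hsw m)
    have h3 := h1 (hS (m + 1)) P hP
    have h4 := frobSq_nonneg (V (m + 1) - V m)
    have h5 := mul_le_mul_of_nonneg_left hPres hC₁.le
    linarith
  obtain ⟨N, hN⟩ := eventually_atTop.1 herr
  have htend : Tendsto (fun m => objective A Ustar - objective A (V (N + m))) atTop (𝓝 0) := by
    have h1 : Tendsto (fun m => V (N + m)) atTop (𝓝 Ustar) :=
      hV.comp (tendsto_atTop_mono (fun m => Nat.le_add_left m N) tendsto_id)
    simpa using (((continuous_objective A).tendsto Ustar).comp h1).const_sub (objective A Ustar)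
  obtain ⟨q, hq0, hq1, hQ, hD⟩ := linear_rates
    (a := fun m => objective A Ustar - objective A (V (N + m)))
    (D := fun m => frobSq (V (N + m + 1) - V (N + m))) (K := C₁ * C₂ + 1) hε (by positivity)
    (fun _ => frobSq_nonneg _)
    (fun m => by
      have := (hsw (N + m)).increase (hS (N + m))
      simp only [← add_assoc]
      linarith)
    (fun m => hN (N + m) (Nat.le_add_right N m)) htend
  set M₀ := (objective A Ustar - objective A (V (N + 0))) / ε
  -- The squared steps decay like `q ^ m`, so the steps decay like `√q ^ m`; since `q ≤ √q`, the
  -- rate `√q` serves for both conclusions.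
  have hsq1 : √q < 1 := by rw [Real.sqrt_lt' one_pos]; simpa using hq1
  have hsq0 : 0 < √q := Real.sqrt_pos.2 hq0
  have hqs : q ≤ √q := by nlinarith [Real.sq_sqrt hq0.le]
  have hdist := dist_le_of_le_geometric_of_tendsto (f := fun m => toEuclidean (V (N + m)))
    (a := toEuclidean Ustar) (r := √q) (C := √M₀) hsq1
    (fun m => by
      rw [dist_comm, ← frobDist_eq_dist]
      have h1 : √(q ^ m) = √q ^ m := by
        rw [Real.sqrt_eq_iff_mul_self_eq (by positivity) (by positivity), ← mul_pow,
          Real.mul_self_sqrt hq0.le]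
      rw [← h1, ← Real.sqrt_mul' _ (by positivity)]
      exact Real.sqrt_le_sqrt (hD m))
    (by
      have h1 : Tendsto (fun m => V (N + m)) atTop (𝓝 Ustar) :=
        hV.comp (tendsto_atTop_mono (fun m => Nat.le_add_left m N) tendsto_id)
      refine ((PiLp.continuous_toLp 2 _).tendsto _).comp (tendsto_pi_nhds.2 fun p => ?_)
      exact tendsto_pi_nhds.1 (tendsto_pi_nhds.1 (tendsto_pi_nhds.1 h1 p.1) p.2.1) p.2.2)
  -- The geometric tail sum is `√M₀ / (1 - √q)`; dividing by `√q ^ N` undoes the index shift.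
  refine ⟨N, √M₀ / (1 - √q) / √q ^ N, √q, hsq0, hsq1, fun m hm => ?_, fun m hm => ?_⟩
  · obtain ⟨l, rfl⟩ := Nat.exists_eq_add_of_le hm
    have h := hQ l
    rw [abs_sub_comm, abs_sub_comm (objective A Ustar)] at h
    exact h.trans (mul_le_mul_of_nonneg_right hqs (abs_nonneg _))
  · obtain ⟨l, rfl⟩ := Nat.exists_eq_add_of_le hm
    rw [frobDist_eq_dist]
    refine (hdist l).trans_eq ?_
    have : (1 : ℝ) - √q ≠ 0 := by linarith
    field_simp
    ring

/-! ### Sequences generated by the algorithm -/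

theorem IsSweep.stiefel {r : ℕ} {A : Tensor n} {ε : ℝ} {U U' : Factors n r}
    (h : IsSweep A ε U U') (i : Fin k) : Stiefel (U' i) := (h i).stiefel

/-- A truncation that keeps the number of columns is trivial. -/
theorem IsTruncation.eq_of_same_rank {r : ℕ} {A : Tensor n} {κ : ℝ} {W U' : Factors n r}
    (h : IsTruncation A κ W U') : U' = W := by
  obtain ⟨J, -, -, e, -, he⟩ := h
  -- An order embedding of `Fin r` into itself is bijective, hence the unique order automorphism,
  -- the identity.
  have hsurj : Function.Surjective e := Finite.injective_iff_surjective.1 e.injective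
  have hid : ∀ j, e j = j := fun j =>
    congrArg (fun f : Fin r ≃o Fin r => f j)
      (Subsingleton.elim (RelIso.ofSurjective e hsurj : Fin r ≃o Fin r) (OrderIso.refl _))
  funext i
  ext a j
  rw [he i, Matrix.submatrix_apply, hid, id]

theorem isSweep_castCols {r r' s : ℕ} (h : r = s) (h' : r' = s) {A : Tensor n} {ε κ : ℝ}
    {U W : Factors n r} {U' : Factors n r'} (hsw : IsSweep A ε U W)
    (htr : IsTruncation A κ W U') : IsSweep A ε (castCols h U) (castCols h' U') := by
  subst h
  subst h'
  obtain rfl := htr.eq_of_same_rank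
  exact hsw

theorem objective_castCols {r s : ℕ} (h : r = s) (A : Tensor n) (U : Factors n r) :
    objective A (castCols h U) = objective A U := by
  subst h; rfl

end LROTA

theorem theorem4p7 {k : ℕ} (hk : 3 ≤ k) (n : Fin k → ℕ) (A : LROTA.Tensor n) (hA : A ≠ 0)
    (ε κ : ℝ) (r : ℕ → ℕ) (U : ∀ p : ℕ, LROTA.Factors n (r p))
    (hU : LROTA.IsIAPDSequence A ε κ r U)
    (s : ℕ) (Ustar : LROTA.Factors n s)
    (hlim : LROTA.ConvergesTo U Ustar)
    (hstar : LROTA.IsNondegenerateKKT A Ustar) :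
    LROTA.QLinearlyConvergesTo (fun p => LROTA.objective A (U p)) (LROTA.objective A Ustar) ∧
      LROTA.RLinearlyConvergesTo U Ustar := by
  -- The radius `1` is arbitrary: only the eventual constancy of the number of columns is used here.
  obtain ⟨N₀, hN₀⟩ := hlim 1 one_pos
  have hr : ∀ m, r (N₀ + m) = s := fun m => (hN₀ (N₀ + m) (Nat.le_add_right _ _)).1
  have hsw : ∀ m, LROTA.IsSweep A ε (LROTA.castCols (hr m) (U (N₀ + m)))
      (LROTA.castCols (hr (m + 1)) (U (N₀ + (m + 1)))) := by
    intro m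
    obtain ⟨W, hW, hT⟩ := hU.step (N₀ + m)
    exact LROTA.isSweep_castCols (hr m) (hr (m + 1)) hW hT
  set V : ℕ → LROTA.Factors n s := fun m => LROTA.castCols (hr m) (U (N₀ + m))
  have hV : Filter.Tendsto V Filter.atTop (nhds Ustar) := by
    refine LROTA.tendsto_of_frobDist (Metric.tendsto_atTop.2 fun δ hδ => ?_)
    obtain ⟨N, hN⟩ := hlim δ hδ
    refine ⟨N, fun m hm => ?_⟩
    obtain ⟨h, hd⟩ := hN (N₀ + m) (by omega)
    rw [Real.dist_eq, sub_zero, LROTA.frobDist_eq,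
      abs_of_nonneg (Real.sqrt_nonneg _)]
    exact hd
  -- Starting one index later makes every term the output of a sweep, so orthonormality is
  -- immediate.
  obtain ⟨N, M, q, hq0, hq1, hQ, hR⟩ := LROTA.sweeps_linear_rates (by omega) hU.prox_pos hstar
    ((Filter.tendsto_add_atTop_iff_nat 1).2 hV) (fun m => (hsw m).stiefel) (fun m => hsw (m + 1))
  have hobj : ∀ m, LROTA.objective A (V m) = LROTA.objective A (U (N₀ + m)) := fun m =>
    LROTA.objective_castCols _ A _
  refine ⟨⟨?_, q, hq0, hq1, ?_⟩, M / q ^ (N₀ + 1), q, hq0, hq1, N₀ + (N + 1), fun p hp => ?_⟩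
  · have h := ((LROTA.continuous_objective A).tendsto Ustar).comp hV
    refine (Filter.tendsto_add_atTop_iff_nat N₀).1 (h.congr fun m => ?_)
    rw [Nat.add_comm]
    exact hobj m
  · refine Filter.eventually_atTop.2 ⟨N₀ + (N + 1), fun p hp => ?_⟩
    obtain ⟨m, rfl⟩ : ∃ m, p = N₀ + (m + 1) := ⟨p - (N₀ + 1), by omega⟩
    have h := hQ m (by omega)
    rw [hobj, hobj] at h
    exact h
  · obtain ⟨m, rfl⟩ : ∃ m, p = N₀ + (m + 1) := ⟨p - (N₀ + 1), by omega⟩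
    refine ⟨hr (m + 1), (hR m (by omega)).trans_eq ?_⟩
    have : q ≠ 0 := hq0.ne'
    field_simp
    ring
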